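/- Let $Q=(Q,\le,\odot,1)$ be a unital semicartesian quantale: a complete lattice with an associative unital multiplication that distributes over arbitrary joins in each variable and satisfies $a\odot b\le a$ and $a\odot b\le b$ for all $a,b$. Regard $Q$ as a monoidal poset category, let $PSh(Q)=[Q^{op},\mathrm{Set}]$ carry the Day convolution tensor product $\otimes_{Day}$, and let $i:Sh(Q)\hookrightarrow PSh(Q)$ be the full subcategory of sheaves, i.e. of those presheaves $F$ such that for every family $(u_i)_{i\in I}$ in $Q$ with join $u=\bigvee_i u_i$, every family $s_i\in F(u_i)$ with $s_i|_{u_i\odot u_j}=s_j|_{u_i\odot u_j}$ for all $i,j$ has a unique $s\in F(u)$ with $s|_{u_i}=s_i$ for all $i$. A normal enrichment of a reflective embedding $\psi\dashv\varphi:D\to B$ into a monoidal closed category $B$ consists of a monoidal closed structure on $D$ and (lax) monoidal functor structures on $\psi$ and $\varphi$ such that the unit and counit of the adjunction are monoidal natural transformations and $\varphi$, with the induced closed functor structure $\varphi[X,Y]\to[\varphi X,\varphi Y]$, $\varphi^0: I\to\varphi I$, is normal, i.e. $\mathrm{Hom}_D(I,X)\to \mathrm{Hom}_B(I,\varphi X)$,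 $f\mapsto \varphi(f)\circ\varphi^0$, is bijective for every $X$. (Here a monoidal category is closed if every functor $X\otimes-$ has a right adjoint $[X,-]$.) Then: 1. if $F$ is a sheaf and $u\in Q$, then $F(u\odot -)$ is a sheaf; 2. $i$ has a left adjoint, and $PSh(Q)$ is monoidal closed; 3. for every left adjoint $a\dashv i$ (the sheafification), the reflective embedding $a\dashv i$ admits a normal enrichment. It can be chosen so that $F\otimes G=a(iF\otimes_{Day}iG)$ for all sheaves $F,G$, the canonical morphism $a(iF\otimes_{Day} iG)\to a\,i(F\otimes G)\to F\otimes G$ being the identity; in particular $Sh(Q)$ is monoidal closed with this tensor product; 4. any two normal enrichments of $a\dashv i$ agree up to monoidal isomorphism: the identity functor of $Sh(Q)$ has a strong monoidal structure from one to the other that is compatible with the monoidal structures of $a$. -/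

import Mathlib

universe v₁ v₂ u₁ u₂ u

open CategoryTheory MonoidalCategory Opposite

noncomputable section

section Closed

variable {D : Type u₁} [Category.{v₁} D] {B : Type u₂} [Category.{v₂} B]

/-- The canonical morphism `L : [Y, Z] ⟶ [[X, Y], [X, Z]]` of a monoidal closed category: the
transpose of internal composition `[X, Y] ⊗ [Y, Z] ⟶ [X, Z]`. -/
def internalL [MonoidalCategory D] [MonoidalClosed D] (X Y Z : D) :
    (ihom Y).obj Z ⟶ (ihom ((ihom X).obj Y)).obj ((ihom X).obj Z) :=
  MonoidalClosed.curry (MonoidalClosed.comp X Y Z)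

/-- The canonical isomorphism `i : X ⟶ [I, X]` of a monoidal closed category. -/
def internalI [MonoidalCategory D] [MonoidalClosed D] (X : D) : X ⟶ (ihom (𝟙_ D)).obj X :=
  MonoidalClosed.curry (λ_ X).hom

/-- A closed functor structure, in the sense of Eilenberg and Kelly, on a functor between monoidal
closed categories. -/
structure ClosedFunctor [MonoidalCategory D] [MonoidalClosed D] [MonoidalCategory B]
    [MonoidalClosed B] (φ : D ⥤ B) where
  /-- the comparison `φ[X, Y] ⟶ [φX, φY]` -/
  hat (X Y : D) : φ.obj ((ihom X).obj Y) ⟶ (ihom (φ.obj X)).obj (φ.obj Y)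
  /-- the comparison of units `I ⟶ φI` -/
  unit : 𝟙_ B ⟶ φ.obj (𝟙_ D)
  hat_natural_right (X : D) {Y Y' : D} (g : Y ⟶ Y') :
    φ.map ((ihom X).map g) ≫ hat X Y' = hat X Y ≫ (ihom (φ.obj X)).map (φ.map g)
  hat_natural_left {X X' : D} (f : X ⟶ X') (Y : D) :
    φ.map ((MonoidalClosed.pre f).app Y) ≫ hat X Y =
      hat X' Y ≫ (MonoidalClosed.pre (φ.map f)).app (φ.obj Y)
  /-- compatibility with `j : I ⟶ [X, X]` -/
  unit_id (X : D) :
    unit ≫ φ.map (MonoidalClosed.id X) ≫ hat X X = MonoidalClosed.id (φ.obj X)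
  /-- compatibility with `i : X ⟶ [I, X]` -/
  map_internalI (X : D) :
    φ.map (internalI X) ≫ hat (𝟙_ D) X ≫ (MonoidalClosed.pre unit).app (φ.obj X) =
      internalI (φ.obj X)
  /-- compatibility with `L : [Y, Z] ⟶ [[X, Y], [X, Z]]` -/
  map_internalL (X Y Z : D) :
    φ.map (internalL X Y Z) ≫ hat ((ihom X).obj Y) ((ihom X).obj Z) ≫
        (ihom (φ.obj ((ihom X).obj Y))).map (hat X Z) =
      hat Y Z ≫ internalL (φ.obj X) (φ.obj Y) (φ.obj Z) ≫
        (MonoidalClosed.pre (hat X Y)).app ((ihom (φ.obj X)).obj (φ.obj Z))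

namespace ClosedFunctor

open Functor.LaxMonoidal MonoidalClosed

variable [MonoidalCategory D] [MonoidalClosed D] [MonoidalCategory B] [MonoidalClosed B]

/-- A closed functor `φ` is normal if it commutes with the underlying-set functors `Hom(I, -)`,
i.e. if the canonical map `Hom(I, X) → Hom(I, φX)` is bijective for every `X`. -/
def IsNormal {φ : D ⥤ B} (c : ClosedFunctor φ) : Prop :=
  ∀ X : D, Function.Bijective (fun f : 𝟙_ D ⟶ X => c.unit ≫ φ.map f)

/-- The comparison `φ[X, Y] ⟶ [φX, φY]` of a lax monoidal functor: the transpose of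
`φX ⊗ φ[X, Y] ⟶ φ(X ⊗ [X, Y]) ⟶ φY`. -/
def laxHat (φ : D ⥤ B) [φ.LaxMonoidal] (X Y : D) :
    φ.obj ((ihom X).obj Y) ⟶ (ihom (φ.obj X)).obj (φ.obj Y) :=
  curry (μ φ X ((ihom X).obj Y) ≫ φ.map ((ihom.ev X).app Y))

lemma laxHat_ev (φ : D ⥤ B) [φ.LaxMonoidal] (X Y : D) :
    φ.obj X ◁ laxHat φ X Y ≫ (ihom.ev (φ.obj X)).app (φ.obj Y) =
      μ φ X ((ihom X).obj Y) ≫ φ.map ((ihom.ev X).app Y) :=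
  whiskerLeft_curry_ihom_ev_app _ _ _

/-- The closed functor structure induced by a (lax) monoidal functor structure. -/
def ofLaxMonoidal (φ : D ⥤ B) [φ.LaxMonoidal] : ClosedFunctor φ where
  hat := laxHat φ
  unit := ε φ
  hat_natural_right X Y Y' g := by
    apply uncurry_injective
    rw [uncurry_natural_right, uncurry_eq, uncurry_eq, MonoidalCategory.whiskerLeft_comp,
      Category.assoc, laxHat_ev, laxHat_ev, μ_natural_right_assoc, Category.assoc,
      ← Functor.map_comp, ← Functor.map_comp, ihom.ev_naturality]
  hat_natural_left f Y := by
    apply uncurry_injective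
    rw [uncurry_pre_app, uncurry_eq, uncurry_eq, MonoidalCategory.whiskerLeft_comp,
      Category.assoc, laxHat_ev, laxHat_ev, μ_natural_right_assoc, μ_natural_left_assoc,
      ← Functor.map_comp, ← Functor.map_comp, id_tensor_pre_app_comp_ev]
  unit_id X := by
    apply uncurry_injective
    rw [uncurry_eq, MonoidalCategory.whiskerLeft_comp, MonoidalCategory.whiskerLeft_comp,
      Category.assoc, Category.assoc, laxHat_ev, μ_natural_right_assoc, ← Functor.map_comp,
      MonoidalClosed.id, MonoidalClosed.id, whiskerLeft_curry_ihom_ev_app, uncurry_curry]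
    exact (right_unitality φ X).symm
  map_internalI X := by
    apply uncurry_injective
    rw [internalI, internalI, uncurry_curry, ← Category.assoc, uncurry_pre_app, uncurry_eq,
      MonoidalCategory.whiskerLeft_comp, Category.assoc, laxHat_ev, μ_natural_right_assoc,
      ← Functor.map_comp, whiskerLeft_curry_ihom_ev_app]
    exact (left_unitality φ X).symm
  map_internalL X Y Z := by
    have h₁ : uncurry (φ.map (internalL X Y Z) ≫ laxHat φ ((ihom X).obj Y) ((ihom X).obj Z) ≫
        (ihom (φ.obj ((ihom X).obj Y))).map (laxHat φ X Z)) =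
        μ φ _ _ ≫ φ.map (MonoidalClosed.comp X Y Z) ≫ laxHat φ X Z := by
      rw [← Category.assoc, uncurry_natural_right, uncurry_eq, MonoidalCategory.whiskerLeft_comp,
        Category.assoc, Category.assoc, reassoc_of% laxHat_ev, μ_natural_right_assoc,
        ← Functor.map_comp_assoc, internalL, whiskerLeft_curry_ihom_ev_app]
    have h₂ : uncurry (laxHat φ Y Z ≫ internalL (φ.obj X) (φ.obj Y) (φ.obj Z) ≫
        (pre (laxHat φ X Y)).app ((ihom (φ.obj X)).obj (φ.obj Z))) =
        laxHat φ X Y ▷ _ ≫ _ ◁ laxHat φ Y Z ≫ MonoidalClosed.comp _ _ _ := by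
      rw [← Category.assoc, uncurry_pre_app, uncurry_natural_left, internalL, uncurry_curry]
    apply uncurry_injective
    rw [h₁, h₂]
    apply uncurry_injective
    simp only [uncurry_eq, MonoidalCategory.whiskerLeft_comp, Category.assoc, laxHat_ev,
      MonoidalClosed.comp, whiskerLeft_curry_ihom_ev_app, μ_natural_right_assoc,
      ← Functor.map_comp, compTranspose]
    simp only [Functor.map_comp]
    rw [associativity_inv_assoc, associator_inv_naturality_right_assoc, whisker_exchange_assoc]
    dsimp only [Functor.id_obj]
    rw [laxHat_ev, associator_inv_naturality_middle_assoc, ← comp_whiskerRight_assoc, laxHat_ev,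
      comp_whiskerRight_assoc]
    erw [μ_natural_left_assoc φ ((ihom.ev X).app Y) ((ihom Y).obj Z)]
    rfl

end ClosedFunctor

/-- A normal enrichment of an adjunction `ψ ⊣ φ : D ⥤ B`, where `B` is monoidal closed: a monoidal
closed structure on `D` and (lax) monoidal functor structures on `ψ` and `φ`, such that `φ` is a
normal closed functor and the unit and counit are monoidal natural transformations. -/
structure NormalEnrichment [MonoidalCategory B] [MonoidalClosed B] {ψ : B ⥤ D} {φ : D ⥤ B}
    (adj : ψ ⊣ φ) where
  monoidal : MonoidalCategory D
  closed : MonoidalClosed D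
  laxLeft : ψ.LaxMonoidal
  laxRight : φ.LaxMonoidal
  normal : (ClosedFunctor.ofLaxMonoidal φ).IsNormal
  unit_isMonoidal : NatTrans.IsMonoidal adj.unit
  counit_isMonoidal : NatTrans.IsMonoidal adj.counit

namespace NormalEnrichment

variable [MonoidalCategory B] [MonoidalClosed B] {ψ : B ⥤ D} {φ : D ⥤ B} {adj : ψ ⊣ φ}

/-- The tensor product of two objects of `D` in a normal enrichment. -/
def tensor (N : NormalEnrichment adj) (X Y : D) : D :=
  letI := N.monoidal
  X ⊗ Y

/-- The canonical morphism `ψ(φX ⊗ φY) ⟶ ψφ(X ⊗ Y) ⟶ X ⊗ Y` in a normal enrichment. -/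
def fromReflection (N : NormalEnrichment adj) (X Y : D) :
    ψ.obj (φ.obj X ⊗ φ.obj Y) ⟶ N.tensor X Y :=
  letI := N.monoidal
  letI := N.laxRight
  ψ.map (Functor.LaxMonoidal.μ φ X Y) ≫ adj.counit.app (X ⊗ Y)

/-- Two normal enrichments agree up to monoidal isomorphism: the identity functor of `D` carries a
strong monoidal structure from the first to the second, for which `ψ` followed by the identity is
`ψ` as a monoidal functor. -/
def Equiv (N N' : NormalEnrichment adj) : Prop :=
  ∃ M : @Functor.Monoidal D _ N.monoidal D _ N'.monoidal (𝟭 D),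
    @NatTrans.IsMonoidal B _ _ D _ N'.monoidal (ψ ⋙ 𝟭 D) ψ ψ.rightUnitor.hom
      (@Functor.LaxMonoidal.comp B _ _ D _ N.monoidal D _ N'.monoidal ψ (𝟭 D) N.laxLeft
        M.toLaxMonoidal) N'.laxLeft

end NormalEnrichment

end Closed

section Quantale

/-- A quantale is semicartesian if `a ⊙ b ≤ a` and `a ⊙ b ≤ b` for all `a`, `b`. -/
class IsSemicartesian (Q : Type u) [Mul Q] [LE Q] : Prop where
  mul_le_left (a b : Q) : a * b ≤ a
  mul_le_right (a b : Q) : a * b ≤ b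

variable (Q : Type u) [Monoid Q] [CompleteLattice Q] [IsQuantale Q]

/-- The (strict) monoidal structure of a unital quantale, seen as a poset category. -/
instance quantaleMonoidalCategory : MonoidalCategory Q where
  tensorObj a b := a * b
  whiskerLeft a _ _ f := homOfLE (mul_le_mul_right (leOfHom f) a)
  whiskerRight f b := homOfLE (mul_le_mul_left (leOfHom f) b)
  tensorUnit := 1
  associator a b c := eqToIso (mul_assoc a b c)
  leftUnitor a := eqToIso (one_mul a)
  rightUnitor a := eqToIso (mul_one a)

/-- The category of presheaves of sets on `Q`, with the Day convolution monoidal structure. -/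
abbrev PSh : Type (u + 1) := DayFunctor Qᵒᵖ (Type u)

variable {Q}

/-- The presheaf `F(u ⊙ -)`. -/
def PSh.shift (F : PSh Q) (u : Q) : PSh Q :=
  ⟨(tensorLeft u).op ⋙ F.functor⟩

/-- The restriction `s|_v` of a section `s ∈ F(u)` along `v ≤ u`. -/
def PSh.res (F : PSh Q) {u v : Q} (h : v ≤ u) (s : F.functor.obj (op u)) : F.functor.obj (op v) :=
  F.functor.map (homOfLE h).op s

variable [IsSemicartesian Q]

/-- A family of sections `s i ∈ F(u i)` is compatible if `s i` and `s j` have the same restriction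
to `u i ⊙ u j`, for all `i`, `j`. -/
def PSh.Compatible (F : PSh Q) {I : Type u} (c : I → Q) (s : ∀ i, F.functor.obj (op (c i))) :
    Prop :=
  ∀ i j, F.res (IsSemicartesian.mul_le_left (c i) (c j)) (s i) =
    F.res (IsSemicartesian.mul_le_right (c i) (c j)) (s j)

/-- A presheaf is a sheaf if, for every cover `u = ⨆ i, c i`, every compatible family of sections
over the `c i` has a unique gluing over `u`. -/
def PSh.IsSheaf (F : PSh Q) : Prop :=
  ∀ (I : Type u) (c : I → Q) (s : ∀ i, F.functor.obj (op (c i))), F.Compatible c s →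
    ∃! t : F.functor.obj (op (⨆ i, c i)), ∀ i, F.res (le_iSup c i) t = s i

variable (Q)

/-- The full subcategory of sheaves. -/
abbrev Sh : Type (u + 1) := ObjectProperty.FullSubcategory (PSh.IsSheaf (Q := Q))

/-- The inclusion of sheaves into presheaves. -/
abbrev shInclusion : Sh Q ⥤ PSh Q := ObjectProperty.ι (PSh.IsSheaf (Q := Q))

end Quantale

end

/-! Everything reduces to one closure property: the internal homs of presheaves into a sheaf are
sheaves. For `F` a sheaf, `F(q ⊙ -)` and `F(- ⊙ q)` are sheaves, since multiplication by `q`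
preserves joins and semicartesianness gives `(q ⊙ a) ⊙ (q ⊙ b) ≤ q ⊙ (a ⊙ b)` and its mirror image.
Both internal homs of Day convolution into `F` are limits of such shifts (`PSh.IsSheaf.dayLeftHom`,
`PSh.IsSheaf.dayRightHom`).

A morphism is inverted by sheafification iff homs into every sheaf see it as a bijection. By the two
hom-tensor adjunctions this class is stable under tensoring on either side
(`isMonoidal_inverseImage_isomorphisms`). Sheaves are the localization at this class, so they
inherit a monoidal structure for which the reflector is strong monoidal. Closedness follows from the
closure property, normality from invertibility of the reflector's unit comparison. A final change of
tensor product makes `F ⊗ G` literally the reflection of the ambient tensor.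

Conversely, the unit and counit axioms force the reflector of any normal enrichment to be strong
monoidal, and a monoidal structure making a localization functor strong monoidal is unique up to
monoidal isomorphism.

The reflector itself is built syntactically: formal restrictions and gluings, kept when they have a
value in every sheaf under `P` and identified when those values agree. -/

noncomputable section

/-! ### Replacing a tensor product by an isomorphic one. -/

section Retensor

variable {D : Type u₁} [Category.{v₁} D] [MonoidalCategory D]

/-- A copy of a monoidal category `D`, with the tensor product of `X` and `Y` replaced by the
isomorphic object `T X Y`. -/
def Retensor {T : D → D → D} (_ : ∀ X Y, X ⊗ Y ≅ T X Y) : Type u₁ := D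

namespace Retensor

variable {T : D → D → D} (τ : ∀ X Y, X ⊗ Y ≅ T X Y)

instance : Category (Retensor τ) := inferInstanceAs (Category D)

instance : MonoidalCategoryStruct (Retensor τ) where
  tensorObj X Y := T X Y
  whiskerLeft {X : D} {Y Z : D} (f : Y ⟶ Z) := (τ X Y).inv ≫ X ◁ f ≫ (τ X Z).hom
  whiskerRight {X Y : D} (f : X ⟶ Y) (Z : D) := (τ X Z).inv ≫ f ▷ Z ≫ (τ Y Z).hom
  tensorHom {X₁ Y₁ X₂ Y₂ : D} (f : X₁ ⟶ Y₁) (g : X₂ ⟶ Y₂) :=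
    (τ X₁ X₂).inv ≫ MonoidalCategoryStruct.tensorHom (C := D) f g ≫ (τ Y₁ Y₂).hom
  tensorUnit := (𝟙_ D : D)
  associator (X Y Z : D) := ((τ (T X Y) Z).symm ≪≫ whiskerRightIso (τ X Y).symm Z ≪≫ α_ X Y Z ≪≫
    whiskerLeftIso X (τ Y Z) ≪≫ τ X (T Y Z) : T (T X Y) Z ≅ T X (T Y Z))
  leftUnitor (X : D) := ((τ (𝟙_ D) X).symm ≪≫ λ_ X : T (𝟙_ D) X ≅ X)
  rightUnitor (X : D) := ((τ X (𝟙_ D)).symm ≪≫ ρ_ X : T X (𝟙_ D) ≅ X)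

/-- The identity functor from `Retensor τ` to the original monoidal category. -/
def forget : Retensor τ ⥤ D := 𝟭 D

/-- The identity functor to `Retensor τ` from the original monoidal category. -/
def of : D ⥤ Retensor τ := 𝟭 D

instance : (forget τ).Faithful := inferInstanceAs (𝟭 D).Faithful

/-- The identity functor of `D` satisfies the compatibilities that make `Retensor τ` monoidal. -/
def inducingFunctorData : Monoidal.InducingFunctorData (forget τ) where
  μIso (X Y : D) := τ X Y
  εIso := Iso.refl (𝟙_ D)
  whiskerLeft_eq _ _ _ _ := rfl
  whiskerRight_eq _ _ := rfl
  tensorHom_eq _ _ := rfl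
  associator_eq (X Y Z : D) := by
    change (τ (T X Y) Z).inv ≫ (τ X Y).inv ▷ Z ≫ (α_ X Y Z).hom ≫ X ◁ (τ Y Z).hom ≫ _ =
      ((τ (T X Y) Z).inv ≫ ((τ X Y).inv ⊗ₘ 𝟙 Z)) ≫ (α_ X Y Z).hom ≫ (𝟙 X ⊗ₘ (τ Y Z).hom) ≫ _
    simp only [tensorHom_id, id_tensorHom, Category.assoc]
    rfl
  leftUnitor_eq (X : D) := by
    change (τ (𝟙_ D) X).inv ≫ (λ_ X).hom = ((τ (𝟙_ D) X).inv ≫ (𝟙 _ ⊗ₘ 𝟙 X)) ≫ (λ_ X).hom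
    simp
  rightUnitor_eq (X : D) := by
    change (τ X (𝟙_ D)).inv ≫ (ρ_ X).hom = ((τ X (𝟙_ D)).inv ≫ (𝟙 X ⊗ₘ 𝟙 _)) ≫ (ρ_ X).hom
    simp

instance : MonoidalCategory (Retensor τ) := Monoidal.induced (forget τ) (inducingFunctorData τ)

instance : (of τ).Monoidal := Functor.CoreMonoidal.toMonoidal
  { εIso := Iso.refl (𝟙_ D)
    μIso (X Y : D) := (τ X Y).symm
    μIso_hom_natural_left {X Y : D} f Z := by
      change ((τ X Z).inv ≫ f ▷ Z ≫ (τ Y Z).hom) ≫ (τ Y Z).inv = (τ X Z).inv ≫ f ▷ Z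
      simp
    μIso_hom_natural_right {X Y : D} Z f := by
      change ((τ Z X).inv ≫ Z ◁ f ≫ (τ Z Y).hom) ≫ (τ Z Y).inv = (τ Z X).inv ≫ Z ◁ f
      simp
    associativity (X Y Z : D) := by
      change ((τ (T X Y) Z).inv ≫ (τ X Y).inv ▷ Z ≫ (τ (X ⊗ Y) Z).hom) ≫ (τ (X ⊗ Y) Z).inv ≫
          (α_ X Y Z).hom = ((τ (T X Y) Z).inv ≫ (τ X Y).inv ▷ Z ≫ (α_ X Y Z).hom ≫
            X ◁ (τ Y Z).hom ≫ (τ X (T Y Z)).hom) ≫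
          ((τ X (T Y Z)).inv ≫ X ◁ (τ Y Z).inv ≫ (τ X (Y ⊗ Z)).hom) ≫ (τ X (Y ⊗ Z)).inv
      simp
    left_unitality (X : D) := by
      change (τ (𝟙_ D) X).inv ≫ (λ_ X).hom = ((τ (𝟙_ D) X).inv ≫ 𝟙 _ ▷ X ≫ (τ (𝟙_ D) X).hom) ≫
        (τ (𝟙_ D) X).inv ≫ (λ_ X).hom
      simp
    right_unitality (X : D) := by
      change (τ X (𝟙_ D)).inv ≫ (ρ_ X).hom = ((τ X (𝟙_ D)).inv ≫ X ◁ 𝟙 _ ≫ (τ X (𝟙_ D)).hom) ≫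
        (τ X (𝟙_ D)).inv ≫ (ρ_ X).hom
      simp }

/-- Tensoring on the left in `Retensor τ` agrees with tensoring on the left in `D`. -/
def tensorLeftIso (X : D) : tensorLeft X ≅ of τ ⋙ tensorLeft ((of τ).obj X) ⋙ forget τ :=
  NatIso.ofComponents (τ X) (fun {Y Z} f => by
    change X ◁ f ≫ (τ X Z).hom = (τ X Y).hom ≫ (τ X Y).inv ≫ X ◁ f ≫ (τ X Z).hom
    simp)

instance [MonoidalClosed D] : MonoidalClosed (Retensor τ) where
  closed (X : D) :=
    { rightAdj := (ihom X : D ⥤ D)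
      adj := (ihom.adjunction X).ofNatIsoLeft (tensorLeftIso τ X) }

end Retensor

end Retensor

/-! ### Monoidal adjunctions and normal enrichments. -/

section Reflection

open Functor.LaxMonoidal Functor.OplaxMonoidal

variable {D : Type u₁} [Category.{v₁} D] {B : Type u₂} [Category.{v₂} B] [MonoidalCategory B]
  {ψ : B ⥤ D} {φ : D ⥤ B} (adj : ψ ⊣ φ)

section

variable [MonoidalCategory D]

/-- The right adjoint of a strong monoidal functor commutes with the underlying-set functors. -/
lemma bijective_ε_comp_map [ψ.Monoidal] [φ.LaxMonoidal] [adj.IsMonoidal] (X : D) :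
    Function.Bijective (fun f : 𝟙_ D ⟶ X => ε φ ≫ φ.map f) := by
  -- The map is a composite of two bijections: precomposition with the unit isomorphism of `ψ`, then
  -- transposition across the adjunction.
  have h : (fun f : 𝟙_ D ⟶ X => ε φ ≫ φ.map f) =
      (((Functor.Monoidal.εIso ψ).homFromEquiv (Z := X)).trans (adj.homEquiv (𝟙_ B) X)) := by
    ext f
    simp [Adjunction.homEquiv_unit, ← adj.unit_app_unit_comp_map_η]
  rw [h]
  exact Equiv.bijective _

/-- A strong monoidal structure on the left adjoint gives a normal enrichment, the right adjoint
carrying the induced lax monoidal structure. -/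
def NormalEnrichment.ofMonoidal [MonoidalClosed D] [MonoidalClosed B] [ψ.Monoidal] :
    NormalEnrichment adj :=
  letI := adj.rightAdjointLaxMonoidal
  { monoidal := inferInstance
    closed := inferInstance
    laxLeft := inferInstance
    laxRight := inferInstance
    normal := bijective_ε_comp_map adj
    unit_isMonoidal := inferInstance
    counit_isMonoidal := inferInstance }

/-- The induced `μ φ X Y` is by definition the transpose of the right-hand side, and
`fromReflection` transposes it back. -/
lemma NormalEnrichment.fromReflection_ofMonoidal [MonoidalClosed D] [MonoidalClosed B] [ψ.Monoidal]
    (X Y : D) : (ofMonoidal adj).fromReflection X Y =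
      δ ψ (φ.obj X) (φ.obj Y) ≫ (adj.counit.app X ⊗ₘ adj.counit.app Y) := by
  let := adj.rightAdjointLaxMonoidal
  change ψ.map (μ φ X Y) ≫ adj.counit.app _ = _
  rw [Adjunction.rightAdjointLaxMonoidal_μ]
  exact (adj.homEquiv_counit ..).symm.trans (Equiv.symm_apply_apply _ _)

/-- In a monoidal adjunction the unit comparison of the left adjoint is invertible. -/
lemma isIso_ε_of_isMonoidal [ψ.LaxMonoidal] [φ.LaxMonoidal] [NatTrans.IsMonoidal adj.unit]
    [NatTrans.IsMonoidal adj.counit] : IsIso (ε ψ) := by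
  have h₁ := NatTrans.IsMonoidal.unit (τ := adj.unit)
  have h₂ := NatTrans.IsMonoidal.unit (τ := adj.counit)
  simp only [comp_ε, id_ε, Functor.id_obj, Category.id_comp, Category.assoc] at h₁ h₂
  -- The inverse is the transpose of `ε φ`; monoidality of the counit gives one identity, that of
  -- the unit the other.
  refine ⟨ψ.map (ε φ) ≫ adj.counit.app _, h₂, ?_⟩
  rw [Category.assoc, ← adj.counit_naturality, ← ψ.map_comp_assoc, ← h₁,
    adj.left_triangle_components]

/-- In a monoidal adjunction the tensor comparison of the left adjoint is invertible. -/
lemma isIso_μ_of_isMonoidal [ψ.LaxMonoidal] [φ.LaxMonoidal] [NatTrans.IsMonoidal adj.unit]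
    [NatTrans.IsMonoidal adj.counit] (X Y : B) : IsIso (μ ψ X Y) := by
  have h₁ := NatTrans.IsMonoidal.tensor (τ := adj.unit) X Y
  have h₂ := NatTrans.IsMonoidal.tensor (τ := adj.counit) (ψ.obj X) (ψ.obj Y)
  simp only [comp_μ, id_μ, Functor.id_obj, Functor.comp_obj, Category.id_comp, Category.comp_id,
    Category.assoc] at h₁ h₂
  -- The inverse is the transpose of `X ⊗ Y ⟶ φψX ⊗ φψY ⟶ φ(ψX ⊗ ψY)`.
  refine ⟨ψ.map ((adj.unit.app X ⊗ₘ adj.unit.app Y) ≫ μ φ _ _) ≫ adj.counit.app _, ?_, ?_⟩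
  · rw [ψ.map_comp, Category.assoc, ← μ_natural_assoc]
    dsimp only [Functor.comp_obj, Functor.id_obj]
    rw [h₂, tensorHom_comp_tensorHom,
      adj.left_triangle_components, adj.left_triangle_components, id_tensorHom_id]
  · rw [Category.assoc, ← adj.counit_naturality, ← ψ.map_comp_assoc, Category.assoc, ← h₁,
      adj.left_triangle_components]

variable [φ.Full] [φ.Faithful]

section

variable [ψ.Monoidal]

/-- If the reflector is strong monoidal, the tensor product of the subcategory is the reflection of
the ambient one. -/
def reflectionTensorIso (X Y : D) : X ⊗ Y ≅ ψ.obj (φ.obj X ⊗ φ.obj Y) :=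
  (asIso (adj.counit.app X) ⊗ᵢ asIso (adj.counit.app Y)).symm ≪≫ Functor.Monoidal.μIso ψ _ _

lemma reflectionTensorIso_inv (X Y : D) : (reflectionTensorIso adj X Y).inv =
    δ ψ (φ.obj X) (φ.obj Y) ≫ (adj.counit.app X ⊗ₘ adj.counit.app Y) :=
  rfl

lemma reflectionTensorIso_inv_naturality (X : D) {Y Z : D} (f : Y ⟶ Z) :
    (reflectionTensorIso adj X Y).inv ≫ X ◁ f =
      ψ.map (φ.obj X ◁ φ.map f) ≫ (reflectionTensorIso adj X Z).inv := by
  rw [reflectionTensorIso_inv, reflectionTensorIso_inv, ← δ_natural_right_assoc, Category.assoc,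
    ← id_tensorHom, ← id_tensorHom, tensorHom_comp_tensorHom, tensorHom_comp_tensorHom]
  dsimp only [Functor.comp_obj, Functor.id_obj]
  rw [adj.counit_naturality, Category.id_comp, Category.comp_id]

/-- A reflective subcategory with strong monoidal reflector is closed, if it is stable under the
internal homs of the ambient category. -/
@[reducible]
def closedOfReflective [MonoidalClosed B] (R : D → D → D)
    (e : ∀ X Z, φ.obj (R X Z) ≅ (ihom (φ.obj X)).obj (φ.obj Z)) : MonoidalClosed D where
  closed X :=
    { rightAdj := _
      adj := Adjunction.adjunctionOfEquivRight (F := tensorLeft X) (G_obj := R X)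
        -- Hom(X ⊗ Y, Z) ≃ Hom(ψ(φX ⊗ φY), Z) ≃ Hom(φX ⊗ φY, φZ) ≃ Hom(φY, [φX, φZ]) ≃ Hom(φY, φ(R X
        -- Z)) ≃ Hom(Y, R X Z).
        (fun Y Z => (reflectionTensorIso adj X Y).homFromEquiv.trans <|
          (adj.homEquiv _ _).trans <| ((ihom.adjunction (φ.obj X)).homEquiv _ _).trans <|
          (e X Z).symm.homToEquiv.trans
            (Functor.FullyFaithful.ofFullyFaithful φ).homEquiv.symm)
        (fun Y' Y Z f (g : X ⊗ Y ⟶ Z) => φ.map_injective (by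
          have h : adj.unit.app (φ.obj X ⊗ φ.obj Y') ≫ φ.map (reflectionTensorIso adj X Y').inv ≫
              φ.map (X ◁ f) ≫ φ.map g = φ.obj X ◁ φ.map f ≫ adj.unit.app (φ.obj X ⊗ φ.obj Y) ≫
                φ.map (reflectionTensorIso adj X Y).inv ≫ φ.map g := by
            rw [← φ.map_comp_assoc, reflectionTensorIso_inv_naturality, φ.map_comp, Category.assoc,
              ← adj.unit_naturality_assoc]
          have h' := (ihom.adjunction (φ.obj X)).homEquiv_naturality_left (φ.map f)
            (adj.unit.app (φ.obj X ⊗ φ.obj Y) ≫ φ.map (reflectionTensorIso adj X Y).inv ≫ φ.map g)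
          simpa [Adjunction.homEquiv_unit, h] using congrArg (· ≫ (e X Z).inv) h')) }

end

/-- A strong monoidal reflector gives a normal enrichment whose tensor product is, on the nose, the
reflection of the ambient tensor product. -/
theorem exists_normalEnrichment_fromReflection_eq [MonoidalClosed D] [MonoidalClosed B]
    [ψ.Monoidal] :
    ∃ (N : NormalEnrichment adj)
      (h : ∀ X Y : D, N.tensor X Y = ψ.obj (φ.obj X ⊗ φ.obj Y)),
      ∀ X Y : D, N.fromReflection X Y = eqToHom (h X Y).symm := by
  let τ := reflectionTensorIso adj
  -- The same adjunction, with `D` now carrying the strictly reflected tensor product.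
  let adj' : ψ ⋙ Retensor.of τ ⊣ Retensor.forget τ ⋙ φ := adj
  let N : NormalEnrichment adj := NormalEnrichment.ofMonoidal adj'
  refine ⟨N, fun X Y => rfl, fun X Y => ?_⟩
  have h := NormalEnrichment.fromReflection_ofMonoidal adj' X Y
  refine h.trans ?_
  -- In `Retensor τ` the comparison `δ` gains a factor `τ` and the tensor of counits is conjugated
  -- by `τ`. After cancellation, what remains is `τ⁻¹` followed by `τ`.
  change (δ ψ (φ.obj X) (φ.obj Y) ≫ (τ _ _).hom) ≫ (τ _ _).inv ≫
    (adj.counit.app X ⊗ₘ adj.counit.app Y) ≫ (τ X Y).hom = 𝟙 _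
  rw [Category.assoc, Iso.hom_inv_id_assoc, ← Category.assoc]
  exact (τ X Y).inv_hom_id

end

/-! ### Uniqueness of normal enrichments. -/

section Uniqueness

/-- Two monoidal structures for which a localization functor is strong monoidal agree up to
monoidal isomorphism. -/
lemma exists_monoidal_isMonoidal_rightUnitor (W : MorphismProperty B) [W.ContainsIdentities]
    [ψ.IsLocalization W] {M M' : MonoidalCategory D} (S : @Functor.Monoidal B _ _ D _ M ψ)
    (S' : @Functor.Monoidal B _ _ D _ M' ψ) :
    ∃ F : @Functor.Monoidal D _ M D _ M' (𝟭 D),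
      @NatTrans.IsMonoidal B _ _ D _ M' (ψ ⋙ 𝟭 D) ψ ψ.rightUnitor.hom
        (@Functor.LaxMonoidal.comp B _ _ D _ M D _ M' ψ (𝟭 D) S.toLaxMonoidal F.toLaxMonoidal)
        S'.toLaxMonoidal := by
  -- The identity functor lifts `ψ` through itself, so the strong monoidal structure of `ψ` for `M'`
  -- descends along the localization.
  let : Localization.Lifting ψ W ψ (𝟭 D) := ⟨ψ.rightUnitor⟩
  exact ⟨@Localization.Monoidal.functorMonoidalOfComp _ _ _ _ _ _ _ M M' ψ W _ S (𝟭 D) ψ S' _ _,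
    @Localization.Monoidal.lifting_isMonoidal _ _ _ _ _ _ _ M M' ψ W _ S (𝟭 D) ψ S' _ _⟩

variable {adj} [MonoidalClosed B]

/-- The reflector is strong monoidal in every normal enrichment. -/
lemma NormalEnrichment.exists_monoidal_left (N : NormalEnrichment adj) :
    ∃ S : @Functor.Monoidal B _ _ D _ N.monoidal ψ, S.toLaxMonoidal = N.laxLeft := by
  let := N.monoidal
  let := N.laxLeft
  let := N.laxRight
  have := N.unit_isMonoidal
  have := N.counit_isMonoidal
  have := isIso_ε_of_isMonoidal adj
  have := isIso_μ_of_isMonoidal adj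
  exact ⟨Functor.Monoidal.ofLaxMonoidal ψ, rfl⟩

/-- A reflector is a localization at the morphisms it inverts, and it is strong monoidal for both
enrichments. -/
theorem NormalEnrichment.equiv [φ.Full] [φ.Faithful] (N N' : NormalEnrichment adj) : N.Equiv N' := by
  obtain ⟨S, hS⟩ := N.exists_monoidal_left
  obtain ⟨S', hS'⟩ := N'.exists_monoidal_left
  have := adj.isLocalization
  unfold NormalEnrichment.Equiv
  rw [← hS, ← hS']
  exact exists_monoidal_isMonoidal_rightUnitor
    ((MorphismProperty.isomorphisms D).inverseImage ψ) S S'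

end Uniqueness

end Reflection

/-! ### Enrichment by monoidal localization. -/

section Reflection

variable {D : Type u₁} [Category.{v₁} D] {B : Type u₂} [Category.{v₂} B] [MonoidalCategory B]
  {ψ : B ⥤ D} {φ : D ⥤ B} (adj : ψ ⊣ φ)

/-- A reflection whose inverted morphisms are stable under tensoring, and which is stable under
internal homs, has a normal enrichment whose tensor product is the reflection of the ambient one. -/
theorem exists_normalEnrichment_of_isMonoidal [MonoidalClosed B] [φ.Full] [φ.Faithful]
    [((MorphismProperty.isomorphisms D).inverseImage ψ).IsMonoidal] (R : D → D → D)
    (e : ∀ X Z, φ.obj (R X Z) ≅ (ihom (φ.obj X)).obj (φ.obj Z)) :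
    ∃ (N : NormalEnrichment adj)
      (h : ∀ X Y : D, N.tensor X Y = ψ.obj (φ.obj X ⊗ φ.obj Y)),
      ∀ X Y : D, N.fromReflection X Y = eqToHom (h X Y).symm := by
  have := adj.isLocalization
  let W := (MorphismProperty.isomorphisms D).inverseImage ψ
  let i : ψ.obj (𝟙_ B) ≅ ψ.obj (𝟙_ B) := Iso.refl _
  let φ' : LocalizedMonoidal ψ W i ⥤ B := φ
  let adj' : Localization.Monoidal.toMonoidalCategory ψ W i ⊣ φ' := adj
  have : φ'.Full := ‹φ.Full›
  have : φ'.Faithful := ‹φ.Faithful›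
  let := closedOfReflective adj' R e
  exact exists_normalEnrichment_fromReflection_eq adj'

end Reflection

/-! ### Day convolution of set-valued functors and its two internal homs. -/

section DayHom

variable {C : Type u} [SmallCategory C]

lemma type_hom_congr {A B : Type u} {f g : A ⟶ B} (h : f = g) (a : A) : f a = g a := by rw [h]

lemma functor_map_comp_apply (F : C ⥤ Type u) {a b c : C} (f : a ⟶ b) (g : b ⟶ c) (x : F.obj a) :
    F.map (f ≫ g) x = F.map g (F.map f x) :=
  type_hom_congr (F.map_comp f g) x

lemma functor_map_id_apply (F : C ⥤ Type u) {a : C} (x : F.obj a) : F.map (𝟙 a) x = x :=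
  type_hom_congr (F.map_id a) x

lemma natTrans_naturality_apply {F G : C ⥤ Type u} (α : F ⟶ G) {a b : C} (f : a ⟶ b)
    (x : F.obj a) : α.app b (F.map f x) = G.map f (α.app a x) :=
  type_hom_congr (α.naturality f) x

variable [MonoidalCategory C]

/-- The element `x ⊗ y` of the Day convolution of two set-valued functors. -/
def dayPair (X Y : DayFunctor C (Type u)) {u v : C} (x : X.functor.obj u) (y : Y.functor.obj v) :
    (X ⊗ Y).functor.obj (u ⊗ v) :=
  (DayFunctor.η X Y).app (u, v) (x, y)

lemma map_dayPair (X Y : DayFunctor C (Type u)) {u v u' v' : C} (f : u ⟶ u') (g : v ⟶ v')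
    (x : X.functor.obj u) (y : Y.functor.obj v) :
    (X ⊗ Y).functor.map (f ⊗ₘ g) (dayPair X Y x y) =
      dayPair X Y (X.functor.map f x) (Y.functor.map g y) :=
  (type_hom_congr ((DayFunctor.η X Y).naturality (X := (u, v)) (Y := (u', v')) (f, g))
    (x, y)).symm

lemma whiskerLeft_dayPair (X : DayFunctor C (Type u)) {Y Y' : DayFunctor C (Type u)} (g : Y ⟶ Y')
    {u v : C} (x : X.functor.obj u) (y : Y.functor.obj v) :
    (X ◁ g).natTrans.app _ (dayPair X Y x y) = dayPair X Y' x (g.natTrans.app _ y) :=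
  type_hom_congr
    (LawfulDayConvolutionMonoidalCategoryStruct.convolutionExtensionUnit_comp_ι_map_whiskerLeft_app
      (Type u) X g u v) (x, y)

lemma whiskerRight_dayPair {X X' : DayFunctor C (Type u)} (f : X ⟶ X') (Y : DayFunctor C (Type u))
    {u v : C} (x : X.functor.obj u) (y : Y.functor.obj v) :
    (f ▷ Y).natTrans.app _ (dayPair X Y x y) = dayPair X' Y (f.natTrans.app _ x) y :=
  type_hom_congr
    (LawfulDayConvolutionMonoidalCategoryStruct.convolutionExtensionUnit_comp_ι_map_whiskerRight_app
      C (Type u) f Y u v) (x, y)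

/-- Two morphisms out of a Day convolution agree if they agree on the elements `x ⊗ y`. -/
lemma dayTensor_hom_ext {X Y Z : DayFunctor C (Type u)} {f g : X ⊗ Y ⟶ Z}
    (h : ∀ (u v : C) (x : X.functor.obj u) (y : Y.functor.obj v),
      f.natTrans.app _ (dayPair X Y x y) = g.natTrans.app _ (dayPair X Y x y)) : f = g :=
  DayFunctor.tensor_hom_ext fun u v => by
    ext ⟨x, y⟩
    exact h u v x y

/-- The morphism out of a Day convolution given by a natural family of maps in two variables. -/
def dayDesc {X Y Z : DayFunctor C (Type u)}
    (b : ∀ (u v : C), X.functor.obj u → Y.functor.obj v → Z.functor.obj (u ⊗ v))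
    (hb : ∀ ⦃u v u' v' : C⦄ (f : u ⟶ u') (g : v ⟶ v') (x : X.functor.obj u) (y : Y.functor.obj v),
      b u' v' (X.functor.map f x) (Y.functor.map g y) = Z.functor.map (f ⊗ₘ g) (b u v x y)) :
    X ⊗ Y ⟶ Z :=
  DayFunctor.tensorDesc
    { app := fun p => TypeCat.ofHom fun z => b p.1 p.2 z.1 z.2
      naturality := fun p q h => by
        ext ⟨x, y⟩
        exact hb h.1 h.2 x y }

lemma dayDesc_dayPair {X Y Z : DayFunctor C (Type u)}
    (b : ∀ (u v : C), X.functor.obj u → Y.functor.obj v → Z.functor.obj (u ⊗ v))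
    (hb : ∀ ⦃u v u' v' : C⦄ (f : u ⟶ u') (g : v ⟶ v') (x : X.functor.obj u) (y : Y.functor.obj v),
      b u' v' (X.functor.map f x) (Y.functor.map g y) = Z.functor.map (f ⊗ₘ g) (b u v x y))
    {u v : C} (x : X.functor.obj u) (y : Y.functor.obj v) :
    (dayDesc b hb).natTrans.app _ (dayPair X Y x y) = b u v x y :=
  type_hom_congr (DayFunctor.η_comp_tensorDesc_app _ u v) (x, y)

/-- The internal hom `v ↦ Hom(X, F(- ⊗ v))`, right adjoint to `X ⊗ -`. -/
def dayLeftHom (X F : DayFunctor C (Type u)) : DayFunctor C (Type u) where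
  functor :=
    { obj v := { s : ∀ u, X.functor.obj u → F.functor.obj (u ⊗ v) //
        ∀ ⦃u u' : C⦄ (f : u ⟶ u') (x : X.functor.obj u),
          s u' (X.functor.map f x) = F.functor.map (f ▷ v) (s u x) }
      map {v v'} g := TypeCat.ofHom fun s => ⟨fun u x => F.functor.map (u ◁ g) (s.1 u x), by
        intro u u' f x
        dsimp only
        rw [s.2, ← functor_map_comp_apply, ← functor_map_comp_apply, whisker_exchange]⟩
      map_id v := by
        ext s u x
        exact (type_hom_congr (congrArg F.functor.map (whiskerLeft_id u v)) _).trans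
          (functor_map_id_apply _ _)
      map_comp f g := by
        ext s u x
        exact (type_hom_congr (congrArg F.functor.map (whiskerLeft_comp u f g)) _).trans
          (functor_map_comp_apply _ _ _ _) }

/-- The internal hom `u ↦ Hom(Y, F(u ⊗ -))`, right adjoint to `- ⊗ Y`. -/
def dayRightHom (Y F : DayFunctor C (Type u)) : DayFunctor C (Type u) where
  functor :=
    { obj u := { s : ∀ v, Y.functor.obj v → F.functor.obj (u ⊗ v) //
        ∀ ⦃v v' : C⦄ (g : v ⟶ v') (y : Y.functor.obj v),
          s v' (Y.functor.map g y) = F.functor.map (u ◁ g) (s v y) }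
      map {u u'} f := TypeCat.ofHom fun s => ⟨fun v y => F.functor.map (f ▷ v) (s.1 v y), by
        intro v v' g y
        dsimp only
        rw [s.2, ← functor_map_comp_apply, ← functor_map_comp_apply, whisker_exchange]⟩
      map_id u := by
        ext s v y
        exact (type_hom_congr (congrArg F.functor.map (id_whiskerRight u v)) _).trans
          (functor_map_id_apply _ _)
      map_comp f g := by
        ext s v y
        exact (type_hom_congr (congrArg F.functor.map (comp_whiskerRight f g v)) _).trans
          (functor_map_comp_apply _ _ _ _) }

lemma dayLeftHom_hom_ext {X Y F : DayFunctor C (Type u)} {f g : Y ⟶ dayLeftHom X F}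
    (h : ∀ (v : C) (y : Y.functor.obj v) (u : C) (x : X.functor.obj u),
      (f.natTrans.app v y).1 u x = (g.natTrans.app v y).1 u x) : f = g := by
  apply DayFunctor.hom_ext
  apply NatTrans.ext
  funext v
  ext y
  exact Subtype.ext (funext fun u => funext fun x => h v y u x)

/-- Currying in the right variable of a Day convolution. -/
def dayLeftCurry {X Y F : DayFunctor C (Type u)} (f : X ⊗ Y ⟶ F) : Y ⟶ dayLeftHom X F where
  natTrans :=
    { app v := TypeCat.ofHom fun y => ⟨fun u x => f.natTrans.app (u ⊗ v) (dayPair X Y x y), by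
        intro u u' h x
        dsimp only
        rw [← natTrans_naturality_apply, ← tensorHom_id, map_dayPair, functor_map_id_apply]⟩
      naturality v v' g := by
        ext y
        refine Subtype.ext (funext fun u => funext fun x => ?_)
        change f.natTrans.app (u ⊗ v') (dayPair X Y x (Y.functor.map g y)) =
          F.functor.map (u ◁ g) (f.natTrans.app (u ⊗ v) (dayPair X Y x y))
        rw [← natTrans_naturality_apply, ← id_tensorHom, map_dayPair, functor_map_id_apply] }

/-- Uncurrying in the right variable of a Day convolution. -/
def dayLeftUncurry {X Y F : DayFunctor C (Type u)} (g : Y ⟶ dayLeftHom X F) : X ⊗ Y ⟶ F :=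
  dayDesc (fun u v x y => (g.natTrans.app v y).1 u x) (by
    intro u v u' v' a b x y
    rw [MonoidalCategory.tensorHom_def, functor_map_comp_apply, ← (g.natTrans.app v y).2 a x]
    exact congrFun (congrFun (congrArg Subtype.val
      (natTrans_naturality_apply g.natTrans b y)) u') _)

lemma dayLeftUncurry_dayPair {X Y F : DayFunctor C (Type u)} (g : Y ⟶ dayLeftHom X F) {u v : C}
    (x : X.functor.obj u) (y : Y.functor.obj v) :
    (dayLeftUncurry g).natTrans.app _ (dayPair X Y x y) = (g.natTrans.app v y).1 u x := by
  rw [dayLeftUncurry, dayDesc_dayPair]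

/-- Homs out of a Day convolution are homs into the internal hom. -/
def dayLeftHomEquiv (X Y F : DayFunctor C (Type u)) : (X ⊗ Y ⟶ F) ≃ (Y ⟶ dayLeftHom X F) where
  toFun := dayLeftCurry
  invFun := dayLeftUncurry
  left_inv f := dayTensor_hom_ext fun _ _ x y => dayLeftUncurry_dayPair (dayLeftCurry f) x y
  right_inv g := dayLeftHom_hom_ext fun _ y _ x => dayLeftUncurry_dayPair g x y

lemma dayRightHom_hom_ext {X Y F : DayFunctor C (Type u)} {f g : X ⟶ dayRightHom Y F}
    (h : ∀ (u : C) (x : X.functor.obj u) (v : C) (y : Y.functor.obj v),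
      (f.natTrans.app u x).1 v y = (g.natTrans.app u x).1 v y) : f = g := by
  apply DayFunctor.hom_ext
  apply NatTrans.ext
  funext u
  ext x
  exact Subtype.ext (funext fun v => funext fun y => h u x v y)

/-- Currying in the left variable of a Day convolution. -/
def dayRightCurry {X Y F : DayFunctor C (Type u)} (f : X ⊗ Y ⟶ F) : X ⟶ dayRightHom Y F where
  natTrans :=
    { app u := TypeCat.ofHom fun x => ⟨fun v y => f.natTrans.app (u ⊗ v) (dayPair X Y x y), by
        intro v v' h y
        dsimp only
        rw [← natTrans_naturality_apply, ← id_tensorHom, map_dayPair, functor_map_id_apply]⟩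
      naturality u u' g := by
        ext x
        refine Subtype.ext (funext fun v => funext fun y => ?_)
        change f.natTrans.app (u' ⊗ v) (dayPair X Y (X.functor.map g x) y) =
          F.functor.map (g ▷ v) (f.natTrans.app (u ⊗ v) (dayPair X Y x y))
        rw [← natTrans_naturality_apply, ← tensorHom_id, map_dayPair, functor_map_id_apply] }

/-- Uncurrying in the left variable of a Day convolution. -/
def dayRightUncurry {X Y F : DayFunctor C (Type u)} (g : X ⟶ dayRightHom Y F) : X ⊗ Y ⟶ F :=
  dayDesc (fun u v x y => (g.natTrans.app u x).1 v y) (by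
    intro u v u' v' a b x y
    rw [tensorHom_def', functor_map_comp_apply, ← (g.natTrans.app u x).2 b y]
    exact congrFun (congrFun (congrArg Subtype.val
      (natTrans_naturality_apply g.natTrans a x)) v') _)

lemma dayRightUncurry_dayPair {X Y F : DayFunctor C (Type u)} (g : X ⟶ dayRightHom Y F) {u v : C}
    (x : X.functor.obj u) (y : Y.functor.obj v) :
    (dayRightUncurry g).natTrans.app _ (dayPair X Y x y) = (g.natTrans.app u x).1 v y := by
  rw [dayRightUncurry, dayDesc_dayPair]

/-- Homs out of a Day convolution are homs into the internal hom. -/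
def dayRightHomEquiv (X Y F : DayFunctor C (Type u)) : (X ⊗ Y ⟶ F) ≃ (X ⟶ dayRightHom Y F) where
  toFun := dayRightCurry
  invFun := dayRightUncurry
  left_inv f := dayTensor_hom_ext fun _ _ x y => dayRightUncurry_dayPair (dayRightCurry f) x y
  right_inv g := dayRightHom_hom_ext fun _ x _ y => dayRightUncurry_dayPair g x y

lemma dayLeftHomEquiv_naturality (X : DayFunctor C (Type u)) {Y Y' : DayFunctor C (Type u)}
    (F : DayFunctor C (Type u)) (g : Y ⟶ Y') (f : X ⊗ Y' ⟶ F) :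
    dayLeftHomEquiv X Y F (X ◁ g ≫ f) = g ≫ dayLeftHomEquiv X Y' F f := by
  exact dayLeftHom_hom_ext fun v y u x =>
    congrArg (f.natTrans.app _) (whiskerLeft_dayPair X g x y)

lemma dayRightHomEquiv_naturality {X X' : DayFunctor C (Type u)} (Y F : DayFunctor C (Type u))
    (g : X ⟶ X') (f : X' ⊗ Y ⟶ F) :
    dayRightHomEquiv X Y F (g ▷ Y ≫ f) = g ≫ dayRightHomEquiv X' Y F f := by
  exact dayRightHom_hom_ext fun u x v y =>
    congrArg (f.natTrans.app _) (whiskerRight_dayPair g Y x y)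

/-- `X ⊗ -` is left adjoint to the internal hom of `X`, for Day convolution. -/
def dayLeftHomAdjunction (X : DayFunctor C (Type u)) :
    tensorLeft X ⊣ Adjunction.rightAdjointOfEquiv (F := tensorLeft X) (dayLeftHomEquiv X)
      (fun _ _ F g f => dayLeftHomEquiv_naturality X F g f) :=
  Adjunction.adjunctionOfEquivRight _ _

/-- Day convolution of set-valued functors is closed. -/
@[reducible]
def dayMonoidalClosed : MonoidalClosed (DayFunctor C (Type u)) where
  closed X := { rightAdj := _, adj := dayLeftHomAdjunction X }

end DayHom

/-! ### Sheaves are closed under shifts and internal homs. -/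

section Sheaves

namespace PSh

variable {Q : Type u} [Monoid Q] [CompleteLattice Q] [IsQuantale Q]

lemma res_res (F : PSh Q) {u v w : Q} (h : v ≤ u) (h' : w ≤ v) (s : F.functor.obj (op u)) :
    F.res h' (F.res h s) = F.res (h'.trans h) s :=
  (functor_map_comp_apply F.functor _ _ s).symm

lemma res_rfl (F : PSh Q) {u : Q} (s : F.functor.obj (op u)) : F.res le_rfl s = s :=
  functor_map_id_apply F.functor s

lemma hom_res {F G : PSh Q} (f : F ⟶ G) {u v : Q} (h : v ≤ u) (s : F.functor.obj (op u)) :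
    f.natTrans.app (op v) (F.res h s) = G.res h (f.natTrans.app (op u) s) :=
  natTrans_naturality_apply f.natTrans _ s

variable [IsSemicartesian Q]

/-- Two sections of a sheaf agree if they agree on a cover. -/
lemma IsSheaf.ext {F : PSh Q} (hF : F.IsSheaf) {I : Type u} {c : I → Q}
    {s t : F.functor.obj (op (⨆ i, c i))}
    (h : ∀ i, F.res (le_iSup c i) s = F.res (le_iSup c i) t) : s = t :=
  (hF I c (fun i => F.res (le_iSup c i) t) fun i j => by rw [res_res, res_res]).unique h fun _ => rfl

/-- A presheaf is a sheaf if its sections are compatible families of sections of a diagram of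
sheaves. -/
lemma isSheaf_of_limit {H : PSh Q} {K E : Type*} {G : K → PSh Q} (hG : ∀ k, (G k).IsSheaf)
    (π : ∀ k, H ⟶ G k) (src tgt : E → K) (m : ∀ e, G (src e) ⟶ G (tgt e))
    (hπ : ∀ (e : E) (u : Q) (s : H.functor.obj (op u)),
      (m e).natTrans.app _ ((π (src e)).natTrans.app _ s) = (π (tgt e)).natTrans.app _ s)
    (inj : ∀ (u : Q) (s t : H.functor.obj (op u)),
      (∀ k, (π k).natTrans.app _ s = (π k).natTrans.app _ t) → s = t)
    (surj : ∀ (u : Q) (t : ∀ k, (G k).functor.obj (op u)),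
      (∀ e, (m e).natTrans.app _ (t (src e)) = t (tgt e)) →
        ∃ s : H.functor.obj (op u), ∀ k, (π k).natTrans.app _ s = t k) : H.IsSheaf := by
  intro I c s hs
  have hc (k : K) : (G k).Compatible c fun i => (π k).natTrans.app _ (s i) := fun i j => by
    rw [← hom_res, ← hom_res, hs i j]
  choose t ht using fun k => (hG k I c _ (hc k)).exists
  -- The gluings in the various `G k` match along the diagram because they do so on the cover, so
  -- they come from one section of `H`.
  obtain ⟨r, hr⟩ := surj _ t fun e => (hG _).ext fun i => by rw [← hom_res, ht, ht, hπ]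
  refine ⟨r, fun i => inj _ _ _ fun k => ?_, fun r' hr' => inj _ _ _ fun k => (hG k).ext fun i => ?_⟩
  · rw [hom_res, hr, ht]
  · rw [hr, ht, ← hom_res, hr']

/-- The presheaf `F(- ⊙ v)`. -/
def shiftRight (F : PSh Q) (v : Q) : PSh Q :=
  ⟨(tensorRight v).op ⋙ F.functor⟩

/-- Gluing along any monotone, join-preserving map for which products of the images refine images of
products. -/
lemma IsSheaf.existsUnique_of_map {F : PSh Q} (hF : F.IsSheaf) (p : Q → Q) (hp : Monotone p)
    (hsup : ∀ (I : Type u) (c : I → Q), p (⨆ i, c i) = ⨆ i, p (c i))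
    (hmul : ∀ a b, p a * p b ≤ p (a * b)) (I : Type u) (c : I → Q)
    (s : ∀ i, F.functor.obj (op (p (c i))))
    (hs : ∀ i j, F.res (hp (IsSemicartesian.mul_le_left (c i) (c j))) (s i) =
      F.res (hp (IsSemicartesian.mul_le_right (c i) (c j))) (s j)) :
    ∃! t : F.functor.obj (op (p (⨆ i, c i))), ∀ i, F.res (hp (le_iSup c i)) t = s i := by
  have hcomp : F.Compatible (fun i => p (c i)) s := fun i j => by
    have := congrArg (F.res (hmul (c i) (c j))) (hs i j)
    rwa [res_res, res_res] at this
  -- The sheaf axiom speaks of `⨆ i, p (c i)`, only propositionally equal to `p (⨆ i, c i)`; a free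
  -- `w` lets the equality be substituted.
  have key : ∀ (w : Q) (hw : w = ⨆ i, p (c i)),
      ∃! t : F.functor.obj (op w), ∀ i, F.res ((le_iSup (fun i => p (c i)) i).trans hw.ge) t = s i := by
    rintro w rfl
    exact hF I _ s hcomp
  exact key _ (hsup I c)

/-- Dropping the second `q` gives `(q * a) * (q * b) ≤ (q * a) * b`, so compatibility over `q * (a *
b)` implies compatibility over the product of the shifted opens. -/
theorem IsSheaf.shift {F : PSh Q} (hF : F.IsSheaf) (q : Q) : (F.shift q).IsSheaf :=
  fun I c s hs => hF.existsUnique_of_map (fun a => q * a) (fun _ _ h => mul_le_mul_right h q)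
    (fun _ _ => Quantale.mul_iSup_distrib) (fun a b => by
      rw [← mul_assoc q a b]
      exact mul_le_mul_right (IsSemicartesian.mul_le_right q b) _) I c s hs

theorem IsSheaf.shiftRight {F : PSh Q} (hF : F.IsSheaf) (q : Q) : (F.shiftRight q).IsSheaf :=
  fun I c s hs => hF.existsUnique_of_map (fun a => a * q) (fun _ _ h => mul_le_mul_left h q)
    (fun _ _ => Quantale.iSup_mul_distrib) (fun a b => by
      rw [← mul_assoc]
      exact mul_le_mul_left (mul_le_mul_left (IsSemicartesian.mul_le_left _ _) _) _) I c s hs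

/-- The internal homs into a sheaf are sheaves. -/
theorem IsSheaf.dayLeftHom {F : PSh Q} (hF : F.IsSheaf) (X : PSh Q) :
    PSh.IsSheaf (dayLeftHom X F) :=
  -- The limit runs over the elements `x ∈ X(u)`, contributing `F(u ⊙ -)`, with a transition map for
  -- each restriction of `x`.
  isSheaf_of_limit (K := Σ u : Q, X.functor.obj (op u))
    (E := Σ' (u v : Q) (_ : v ≤ u), X.functor.obj (op u)) (G := fun k => F.shift k.1)
    (fun k => hF.shift k.1)
    (fun k => ⟨{
      app _ := TypeCat.ofHom fun s => s.1 (op k.1) k.2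
      naturality _ _ _ := rfl }⟩)
    (fun e => ⟨e.1, e.2.2.2⟩) (fun e => ⟨e.2.1, X.res e.2.2.1 e.2.2.2⟩)
    (fun e => ⟨{
      app v := F.functor.map ((homOfLE e.2.2.1).op ▷ v)
      naturality _ _ _ := (F.functor.map_comp _ _).symm.trans
        ((congrArg F.functor.map (Subsingleton.elim _ _)).trans (F.functor.map_comp _ _)) }⟩)
    (fun _ _ s => (s.2 _ _).symm)
    (fun _ _ _ h => Subtype.ext (funext fun v => funext fun x => h ⟨v.unop, x⟩))
    (fun _ t ht => ⟨⟨fun v x => t ⟨v.unop, x⟩, fun v v' f x =>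
      (ht ⟨v.unop, v'.unop, leOfHom f.unop, x⟩).symm⟩, fun _ => rfl⟩)

/-- The internal homs into a sheaf are sheaves. -/
theorem IsSheaf.dayRightHom {F : PSh Q} (hF : F.IsSheaf) (X : PSh Q) :
    PSh.IsSheaf (dayRightHom X F) :=
  isSheaf_of_limit (K := Σ u : Q, X.functor.obj (op u))
    (E := Σ' (u v : Q) (_ : v ≤ u), X.functor.obj (op u)) (G := fun k => F.shiftRight k.1)
    (fun k => hF.shiftRight k.1)
    (fun k => ⟨{
      app _ := TypeCat.ofHom fun s => s.1 (op k.1) k.2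
      naturality _ _ _ := rfl }⟩)
    (fun e => ⟨e.1, e.2.2.2⟩) (fun e => ⟨e.2.1, X.res e.2.2.1 e.2.2.2⟩)
    (fun e => ⟨{
      app v := F.functor.map (v ◁ (homOfLE e.2.2.1).op)
      naturality _ _ _ := (F.functor.map_comp _ _).symm.trans
        ((congrArg F.functor.map (Subsingleton.elim _ _)).trans (F.functor.map_comp _ _)) }⟩)
    (fun _ _ s => (s.2 _ _).symm)
    (fun _ _ _ h => Subtype.ext (funext fun v => funext fun x => h ⟨v.unop, x⟩))
    (fun _ t ht => ⟨⟨fun v x => t ⟨v.unop, x⟩, fun v v' f x =>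
      (ht ⟨v.unop, v'.unop, leOfHom f.unop, x⟩).symm⟩, fun _ => rfl⟩)

end PSh

variable {Q : Type u} [Monoid Q] [CompleteLattice Q] [IsQuantale Q] [IsSemicartesian Q]

/-- The morphisms inverted by sheafification are stable under Day convolution. -/
lemma isMonoidal_inverseImage_isomorphisms {a : PSh Q ⥤ Sh Q} (adj : a ⊣ shInclusion Q) :
    ((MorphismProperty.isomorphisms (Sh Q)).inverseImage a).IsMonoidal := by
  -- The inverted morphisms are those `g` for which precomposition with `g` is bijective on homs
  -- into every sheaf; both whiskerings are then moved into an internal hom.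
  rw [← ObjectProperty.isLocal_eq_inverseImage_isomorphisms adj]
  refine { whiskerLeft := ?_, whiskerRight := ?_ }
  · rintro X Y₁ Y₂ g hg _ ⟨Z, rfl⟩
    have h := hg _ ⟨⟨dayLeftHom X Z.obj, Z.property.dayLeftHom X⟩, rfl⟩
    rw [← (dayLeftHomEquiv X Y₁ Z.obj).comp_bijective]
    convert! h.comp (dayLeftHomEquiv X Y₂ Z.obj).bijective using 1
    funext f
    exact dayLeftHomEquiv_naturality X Z.obj g f
  · rintro X₁ X₂ f hf Y _ ⟨Z, rfl⟩
    have h := hf _ ⟨⟨dayRightHom Y Z.obj, Z.property.dayRightHom Y⟩, rfl⟩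
    rw [← (dayRightHomEquiv X₁ Y Z.obj).comp_bijective]
    convert! h.comp (dayRightHomEquiv X₂ Y Z.obj).bijective using 1
    funext g
    exact dayRightHomEquiv_naturality Y Z.obj f g

theorem exists_normalEnrichment_sheafification [MonoidalClosed (PSh Q)] {a : PSh Q ⥤ Sh Q}
    (adj : a ⊣ shInclusion Q) :
    ∃ (N : NormalEnrichment adj)
      (h : ∀ F G : Sh Q, N.tensor F G =
        a.obj ((shInclusion Q).obj F ⊗ (shInclusion Q).obj G)),
      ∀ F G : Sh Q, N.fromReflection F G = eqToHom (h F G).symm := by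
  have := isMonoidal_inverseImage_isomorphisms adj
  exact exists_normalEnrichment_of_isMonoidal adj
    (fun X Z => ⟨dayLeftHom X.obj Z.obj, Z.property.dayLeftHom X.obj⟩)
    -- The given closed structure is arbitrary; its internal hom is identified with `dayLeftHom` by
    -- uniqueness of right adjoints.
    (fun X Z => ((dayLeftHomAdjunction X.obj).rightAdjointUniq (ihom.adjunction X.obj)).app Z.obj)

end Sheaves

/-! ### Sheafification by formal sections. -/

section Sheafification

namespace PSh

variable {Q : Type u} [Monoid Q] [CompleteLattice Q] [IsQuantale Q]

/-- Formal sections over `u` of the sheafification of `P`: sections of `P`, formal restrictions and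
formal gluings. -/
inductive Term (P : PSh Q) : Q → Type u
  | of {u : Q} (x : P.functor.obj (op u)) : Term P u
  | res {u v : Q} (h : v ≤ u) (t : Term P u) : Term P v
  -- Covers are subsets of `Q` rather than families over an arbitrary `I : Type u`; this keeps `Term
  -- P u` in `Type u`.
  | glue {u : Q} (S : Set Q) (h : u = sSup S) (t : ∀ v : S, Term P v) : Term P u

namespace Term

variable {P : PSh Q}

/-- `Eval f t y` says that the formal section `t` has a value in `F` under `f : P ⟶ F`, and that
this value is `y`. -/
def Eval {F : PSh Q} (f : P ⟶ F) : ∀ {u : Q}, Term P u → F.functor.obj (op u) → Prop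
  | _, of x, y => f.natTrans.app _ x = y
  | _, res h t, y => ∃ z, Eval f t z ∧ F.res h z = y
  | _, glue S h t, y => ∀ v : S, Eval f (t v) (F.res ((le_sSup v.2).trans h.ge) y)

variable [IsSemicartesian Q]

/-- Restriction is a function, and at a gluing two values agree on the cover, where a sheaf is
separated. -/
lemma Eval.unique {F : PSh Q} (hF : F.IsSheaf) (f : P ⟶ F) {u : Q} {t : Term P u}
    {y y' : F.functor.obj (op u)} (h : Eval f t y) (h' : Eval f t y') : y = y' := by
  induction t with
  | of x => exact h.symm.trans h'
  | res _ t ih =>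
    obtain ⟨z, hz, rfl⟩ := h
    obtain ⟨z', hz', rfl⟩ := h'
    rw [ih hz hz']
  | glue S hu t ih =>
    rw [sSup_eq_iSup'] at hu
    subst hu
    exact hF.ext fun v => ih v (h v) (h' v)

/-- A formal section is valid if it has a value in every sheaf under `P`. -/
def Valid {u : Q} (t : Term P u) : Prop :=
  ∀ (F : PSh Q) (_ : F.IsSheaf) (f : P ⟶ F), ∃ y, Eval f t y

variable (P) in
/-- Valid formal sections are identified if they have the same values in every sheaf under `P`. -/
def setoid (u : Q) : Setoid { t : Term P u // t.Valid } where
  r s t := ∀ (F : PSh Q) (_ : F.IsSheaf) (f : P ⟶ F) (y : F.functor.obj (op u)),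
    Eval f s.1 y ↔ Eval f t.1 y
  iseqv := ⟨fun _ _ _ _ _ => Iff.rfl, fun h F hF f y => (h F hF f y).symm,
    fun h h' F hF f y => (h F hF f y).trans (h' F hF f y)⟩

lemma Valid.res {u v : Q} (h : v ≤ u) {t : Term P u} (ht : t.Valid) : (t.res h).Valid :=
  fun F hF f => (ht F hF f).imp' (F.res h) fun y hy => ⟨y, hy, rfl⟩

lemma Valid.of_res {u v : Q} {h : v ≤ u} {t : Term P u} (ht : (t.res h).Valid) : t.Valid :=
  fun F hF f => let ⟨_, z, hz, _⟩ := ht F hF f; ⟨z, hz⟩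

lemma Valid.of_glue {u : Q} {S : Set Q} {h : u = sSup S} {t : ∀ v : S, Term P v}
    (ht : (glue S h t).Valid) (v : S) : (t v).Valid :=
  fun F hF f => let ⟨_, hy⟩ := ht F hF f; ⟨_, hy v⟩

end Term

variable [IsSemicartesian Q]

open Term

/-- The sheafification of `P`: valid formal sections, identified if they have the same values in
every sheaf under `P`. -/
def sheafify (P : PSh Q) : PSh Q where
  functor :=
    { obj u := Quotient (setoid P u.unop)
      map g := TypeCat.ofHom (Quotient.map (fun t => ⟨t.1.res (leOfHom g.unop), t.2.res _⟩)
        fun s t h F hF f y => by simp only [Eval, h F hF f])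
      map_id u := by
        ext t
        induction t using Quotient.ind with | _ t
        refine Quotient.sound fun F hF f y => ?_
        exact ⟨by rintro ⟨z, hz, rfl⟩; rwa [PSh.res_rfl], fun h => ⟨y, h, PSh.res_rfl F y⟩⟩
      map_comp g g' := by
        ext t
        induction t using Quotient.ind with | _ t
        refine Quotient.sound fun F hF f y => ?_
        constructor
        · rintro ⟨z, hz, rfl⟩
          exact ⟨_, ⟨z, hz, rfl⟩, PSh.res_res ..⟩
        · rintro ⟨_, ⟨z, hz, rfl⟩, rfl⟩
          exact ⟨z, hz, (PSh.res_res ..).symm⟩ }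

/-- The section of the sheafification defined by a valid formal section. -/
def sheafifyMk {P : PSh Q} {u : Q} (t : Term P u) (ht : t.Valid) : P.sheafify.functor.obj (op u) :=
  Quotient.mk (setoid P u) ⟨t, ht⟩

lemma sheafifyMk_eq_iff {P : PSh Q} {u : Q} {s t : Term P u} (hs : s.Valid) (ht : t.Valid) :
    sheafifyMk s hs = sheafifyMk t ht ↔ ∀ (F : PSh Q) (_ : F.IsSheaf) (f : P ⟶ F)
      (y : F.functor.obj (op u)), Eval f s y ↔ Eval f t y :=
  Quotient.eq (r := setoid P u)

lemma exists_sheafifyMk {P : PSh Q} {u : Q} (s : P.sheafify.functor.obj (op u)) :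
    ∃ t ht, sheafifyMk (P := P) t ht = s :=
  let ⟨t, h⟩ := Quotient.exists_rep s
  ⟨t.1, t.2, h⟩

/-- The value of a section of the sheafification in a sheaf under `P`. -/
lemma exists_eval_of_sheafify {P F : PSh Q} (hF : F.IsSheaf) (f : P ⟶ F) {u : Q}
    (s : P.sheafify.functor.obj (op u)) :
    ∃ y, ∀ t ht, sheafifyMk t ht = s → Eval f t y := by
  obtain ⟨t, ht, rfl⟩ := exists_sheafifyMk s
  obtain ⟨y, hy⟩ := ht F hF f
  exact ⟨y, fun t' ht' h => ((sheafifyMk_eq_iff ht' ht).1 h F hF f y).2 hy⟩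

/-- The morphism out of the sheafification induced by a morphism to a sheaf. -/
def sheafifyLift {P F : PSh Q} (hF : F.IsSheaf) (f : P ⟶ F) : P.sheafify ⟶ F where
  natTrans :=
    { app u := TypeCat.ofHom fun s => (exists_eval_of_sheafify (u := u.unop) hF f s).choose
      naturality u v g := by
        ext s
        obtain ⟨t, ht, rfl⟩ := exists_sheafifyMk (u := u.unop) s
        refine ((exists_eval_of_sheafify (u := v.unop) hF f _).choose_spec
          (t.res (leOfHom g.unop)) (ht.res _) rfl).unique hF f ⟨_, ?_, rfl⟩
        exact (exists_eval_of_sheafify (u := u.unop) hF f _).choose_spec t ht rfl }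

lemma eval_sheafifyLift {P F : PSh Q} (hF : F.IsSheaf) (f : P ⟶ F) {u : Q} (t : Term P u)
    (ht : t.Valid) : Eval f t ((sheafifyLift hF f).natTrans.app (op u) (sheafifyMk t ht)) :=
  (exists_eval_of_sheafify hF f (sheafifyMk t ht)).choose_spec t ht rfl

/-- Sections of the sheafification are determined by their values in the sheaves under `P`. -/
lemma sheafify_ext {P : PSh Q} {u : Q} {s t : P.sheafify.functor.obj (op u)}
    (h : ∀ (F : PSh Q) (hF : F.IsSheaf) (f : P ⟶ F),
      (sheafifyLift hF f).natTrans.app _ s = (sheafifyLift hF f).natTrans.app _ t) : s = t := by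
  obtain ⟨s, hs, rfl⟩ := exists_sheafifyMk s
  obtain ⟨t, ht, rfl⟩ := exists_sheafifyMk t
  refine (sheafifyMk_eq_iff hs ht).2 fun F hF f y => ?_
  have h₁ := eval_sheafifyLift hF f s hs
  have h₂ := eval_sheafifyLift hF f t ht
  rw [h F hF f] at h₁
  exact ⟨fun hy => hy.unique hF f h₁ ▸ h₂, fun hy => hy.unique hF f h₂ ▸ h₁⟩

/-- A compatible family is glued by the formal gluing of representatives. It is valid because the
values of the family in any sheaf under `P` are compatible there; equalities are tested in all such
sheaves. -/
theorem isSheaf_sheafify (P : PSh Q) : P.sheafify.IsSheaf := by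
  intro I c s hs
  choose t ht hts using fun i => exists_sheafifyMk (s i)
  -- An index is chosen for each member of the range of `c`. The choice is harmless, since the value
  -- `y` below restricts to the value of every `s i`.
  let r : ∀ v : Set.range c, Term P v := fun v => (t v.2.choose).res v.2.choose_spec.ge
  let g : Term P (⨆ i, c i) := .glue (Set.range c) sSup_range.symm r
  have hg (F : PSh Q) (hF : F.IsSheaf) (f : P ⟶ F) : ∃ y, Eval f g y ∧
      ∀ i, F.res (le_iSup c i) y = (sheafifyLift hF f).natTrans.app _ (s i) := by
    obtain ⟨y, hy, -⟩ := hF I c (fun i => (sheafifyLift hF f).natTrans.app _ (s i)) fun i j => by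
      rw [← hom_res, ← hom_res, hs i j]
    refine ⟨y, fun v => ⟨_, eval_sheafifyLift hF f _ (ht v.2.choose), ?_⟩, hy⟩
    rw [hts, ← hy, res_res]
  have hgv : g.Valid := fun F hF f => (hg F hF f).imp fun _ h => h.1
  refine ⟨sheafifyMk g hgv, fun i => sheafify_ext fun F hF f => ?_,
    fun s' hs' => sheafify_ext fun F hF f => hF.ext fun i => ?_⟩
  · obtain ⟨y, hy, hys⟩ := hg F hF f
    rw [hom_res, (eval_sheafifyLift hF f g hgv).unique hF f hy, hys]
  · obtain ⟨y, hy, hys⟩ := hg F hF f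
    rw [(eval_sheafifyLift hF f g hgv).unique hF f hy, hys, ← hom_res, hs']

/-- The unit of sheafification. -/
def toSheafify (P : PSh Q) : P ⟶ P.sheafify where
  natTrans :=
    { app u := TypeCat.ofHom fun x => sheafifyMk (u := u.unop) (.of x) fun _ _ _ => ⟨_, rfl⟩
      naturality u v g := by
        ext x
        refine (sheafifyMk_eq_iff (u := v.unop) _ _).2 fun F hF f y => ?_
        have h := natTrans_naturality_apply f.natTrans g x
        exact ⟨fun hy => ⟨_, rfl, h.symm.trans hy⟩, by rintro ⟨_, rfl, rfl⟩; exact h⟩ }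

lemma toSheafify_sheafifyLift {P F : PSh Q} (hF : F.IsSheaf) (f : P ⟶ F) :
    P.toSheafify ≫ sheafifyLift hF f = f := by
  apply DayFunctor.hom_ext
  ext u x
  exact (eval_sheafifyLift (u := u.unop) hF f (.of x) fun _ _ _ => ⟨_, rfl⟩).symm

/-- The value of a formal section is computed by any extension to the sheafification. -/
lemma eval_toSheafify_comp {P F : PSh Q} (g : P.sheafify ⟶ F) {u : Q} (t : Term P u)
    (ht : t.Valid) :
    Eval (P.toSheafify ≫ g) t (g.natTrans.app (op u) (sheafifyMk t ht)) := by
  induction t with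
  | of x => rfl
  | res h t ih => exact ⟨_, ih ht.of_res, (hom_res g h _).symm⟩
  | glue S h t ih =>
    intro v
    have hv : v.1 ≤ _ := (le_sSup v.2).trans h.ge
    -- A formal gluing restricts to its components in the quotient, so any morphism out of the
    -- sheafification respects it.
    have : P.sheafify.res hv (sheafifyMk _ ht) = sheafifyMk (t v) (ht.of_glue v) := by
      refine (sheafifyMk_eq_iff _ _).2 fun F hF f y => ?_
      obtain ⟨z, hz⟩ := ht F hF f
      exact ⟨by rintro ⟨_, hy, rfl⟩; exact hy v, fun hy => ⟨z, hz, (hz v).unique hF f hy⟩⟩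
    rw [← hom_res, this]
    exact ih v (ht.of_glue v)

/-- Formal sections are generated from `P` by operations that every morphism preserves, so both
images are values of one term under the same map from `P`, and such values are unique. -/
lemma sheafify_hom_ext {P F : PSh Q} (hF : F.IsSheaf) {g g' : P.sheafify ⟶ F}
    (h : P.toSheafify ≫ g = P.toSheafify ≫ g') : g = g' := by
  apply DayFunctor.hom_ext
  ext u s
  obtain ⟨t, ht, rfl⟩ := exists_sheafifyMk (u := u.unop) s
  have h₁ := eval_toSheafify_comp g t ht
  rw [h] at h₁
  exact h₁.unique hF _ (eval_toSheafify_comp g' t ht)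

end PSh

variable (Q : Type u) [Monoid Q] [CompleteLattice Q] [IsQuantale Q] [IsSemicartesian Q]

/-- Sheafification is left adjoint to the inclusion of sheaves. -/
theorem isRightAdjoint_shInclusion : (shInclusion Q).IsRightAdjoint :=
  (Adjunction.adjunctionOfEquivLeft (G := shInclusion Q)
    (F_obj := fun P : PSh Q => (⟨P.sheafify, P.isSheaf_sheafify⟩ : Sh Q))
    (fun P F =>
      { toFun g := P.toSheafify ≫ g.hom
        invFun f := ⟨PSh.sheafifyLift F.property f⟩
        left_inv _ := ObjectProperty.hom_ext _
          (PSh.sheafify_hom_ext F.property (PSh.toSheafify_sheafifyLift F.property _))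
        right_inv f := PSh.toSheafify_sheafifyLift F.property f })
    (fun P _ _ g h => (Category.assoc P.toSheafify h.hom g.hom).symm)).isRightAdjoint

end Sheafification

end

theorem mainTheorem6 (Q : Type u) [Monoid Q] [CompleteLattice Q] [IsQuantale Q]
    [IsSemicartesian Q] :
    (∀ (F : PSh Q) (q : Q), F.IsSheaf → (F.shift q).IsSheaf) ∧
    (shInclusion Q).IsRightAdjoint ∧
    Nonempty (MonoidalClosed (PSh Q)) ∧
    ∀ [MonoidalClosed (PSh Q)] (a : PSh Q ⥤ Sh Q) (adj : a ⊣ shInclusion Q),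
      (∃ (N : NormalEnrichment adj)
        (h : ∀ F G : Sh Q, N.tensor F G =
          a.obj ((shInclusion Q).obj F ⊗ (shInclusion Q).obj G)),
        ∀ F G : Sh Q, N.fromReflection F G = eqToHom (h F G).symm) ∧
      ∀ N N' : NormalEnrichment adj, N.Equiv N' :=
  ⟨fun _ q hF => hF.shift q, isRightAdjoint_shInclusion Q, ⟨dayMonoidalClosed⟩,
    fun _ adj => ⟨exists_normalEnrichment_sheafification adj, fun N N' => N.equiv N'⟩⟩
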